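/- Let $d,b\in\mathbb N$ with $b>d+1$ and let $\eta>0$. Consider the Gaussian rank-one model $$A=\mathrm{Id}-\frac{\eta}{b}\sum_{i=1}^b a_ia_i^\top,\qquad B=\frac{\eta}{b}\sum_{i=1}^b y_i a_i,$$ where $(a_i,y_i)$, $1\le i\le b$, are i.i.d. pairs in $\mathbb R^d\times\mathbb R$, with $a_i\sim\mathcal N(0,\mathrm{Id})$ independent of $y_i\sim\mathcal N(0,1)$. Put $H=\sum_{i=1}^b a_ia_i^\top$. Identify the space $\mathrm{Sym}_d(\mathbb R)$ of real symmetric $d\times d$ matrices with $\mathbb R^{d(d+1)/2}$ by sending $g=(g_{ij})$ to the vector $(g_{ij})_{i\le j}$ of its diagonal and upper diagonal entries, and let $|\cdot|$ be the Euclidean norm on $\mathbb R^{d(d+1)/2}$. Then the law of $H$ has a density $f$ with respect to Lebesgue measure on $\mathbb R^{d(d+1)/2}$ such that, for every $D>0$, $$f(x)\le C\,(1+|x|^2)^{-D}\qquad\text{for all }x\in\mathbb R^{d(d+1)/2},$$ with a constant $C=C(D)$ that, for the given $d$ and $b$, depends only on $D$. Consequently the following decay condition holds: the law of $H$ has a density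 $\tilde f$ with respect to Lebesgue measure on $\mathrm{Sym}_d(\mathbb R)$ (transported from $\mathbb R^{d(d+1)/2}$ by the identification above) such that, for some constants $C$ and $D>\frac{d(d+1)}{4}$, $$\tilde f(g)\le C\,(1+\|g\|_F^2)^{-D}\qquad\text{for all }g\in\mathrm{Sym}_d(\mathbb R),$$ where $\|\cdot\|_F$ is the Frobenius norm. -/

import Mathlib

open MeasureTheory ProbabilityTheory
open scoped ENNReal

/-- The space `Sym_d(ℝ)` of real symmetric `d × d` matrices. -/
def SymMat (d : ℕ) : Submodule ℝ (Matrix (Fin d) (Fin d) ℝ) where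
  carrier := {g | g.IsSymm}
  add_mem' hg hh := hg.add hh
  zero_mem' := Matrix.isSymm_zero
  smul_mem' c _ hg := hg.smul c

instance instMeasurableSpaceSymMat (d : ℕ) : MeasurableSpace (SymMat d) := borel _

instance instBorelSpaceSymMat (d : ℕ) : BorelSpace (SymMat d) := ⟨rfl⟩

/-- Positions of the diagonal and upper diagonal entries of a `d × d` matrix. -/
abbrev UpperIdx (d : ℕ) : Type := {p : Fin d × Fin d // p.1 ≤ p.2}

/-- There are `d (d + 1) / 2` such positions. -/
theorem card_upperIdx (d : ℕ) : Fintype.card (UpperIdx d) = d * (d + 1) / 2 := by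
  have e : UpperIdx d ≃ Sym2 (Fin d) :=
    Sym2.sortEquiv.symm
  rw [Fintype.card_congr e, Sym2.card, Fintype.card_fin, Nat.choose_two_right, mul_comm]
  simp

/-- The space `ℝ^{d(d+1)/2}` with its Euclidean norm, coordinates indexed by `i ≤ j`. -/
abbrev UpperVec (d : ℕ) : Type := EuclideanSpace ℝ (UpperIdx d)

/-- The identification of `Sym_d(ℝ)` with `ℝ^{d(d+1)/2}`: a symmetric matrix goes to the vector of
its diagonal and upper diagonal entries. -/
noncomputable def symVec (d : ℕ) : SymMat d ≃ₜ UpperVec d where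
  toFun g := WithLp.toLp 2 fun p => (g : Matrix (Fin d) (Fin d) ℝ) p.1.1 p.1.2
  invFun x := ⟨Matrix.of fun i j => x ⟨(min i j, max i j), min_le_max⟩, by
    ext i j
    simp [min_comm, max_comm]⟩
  left_inv g := by
    ext i j
    have hg : ∀ k l, (g : Matrix (Fin d) (Fin d) ℝ) k l = (g : Matrix (Fin d) (Fin d) ℝ) l k :=
      fun k l => g.2.apply l k
    rcases le_total i j with h | h
    · simp [h]
    · simp [h, hg j i]
  right_inv x := by
    ext ⟨⟨i, j⟩, h⟩
    have h' : i ≤ j := h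
    simp [h']
  continuous_toFun := by
    refine (PiLp.continuous_toLp 2 _).comp (continuous_pi fun p => ?_)
    exact (continuous_subtype_val (p := fun g => g ∈ SymMat d)).matrix_elem p.1.1 p.1.2
  continuous_invFun := by
    refine Continuous.subtype_mk (continuous_matrix fun i j => ?_) _
    simp only [Matrix.of_apply]
    fun_prop

/-- Lebesgue measure on `Sym_d(ℝ)`, transported from `ℝ^{d(d+1)/2}`. -/
noncomputable def lebesgueSym (d : ℕ) : Measure (SymMat d) :=
  (volume : Measure (UpperVec d)).map (symVec d).symm

open scoped Matrix.Norms.Frobenius in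
/-- The Frobenius norm of a symmetric matrix. -/
noncomputable def frobNorm {d : ℕ} (g : SymMat d) : ℝ := ‖(g : Matrix (Fin d) (Fin d) ℝ)‖

/-- The random variable `X` has density `f` with respect to the reference measure `ν`. -/
structure HasDensity {Ω E : Type*} [MeasurableSpace Ω] [MeasurableSpace E] (X : Ω → E)
    (P : Measure Ω) (ν : Measure E) (f : E → ℝ) : Prop where
  measurable : Measurable f
  nonneg : ∀ x, 0 ≤ f x
  hasLaw : HasLaw X (ν.withDensity fun x => ENNReal.ofReal (f x)) P

/-- The decay condition on a random symmetric matrix `H`: its law has a density `f` with respect to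
Lebesgue measure on `Sym_d(ℝ)` such that `f g ≤ C (1 + ‖g‖_F²)^{-D}` for some
`D > d (d + 1) / 4`. -/
def DecaySymm {Ω : Type*} [MeasurableSpace Ω] {d : ℕ} (H : Ω → SymMat d) (P : Measure Ω) : Prop :=
  ∃ f : SymMat d → ℝ, HasDensity H P (lebesgueSym d) f ∧
    ∃ C D : ℝ, (d : ℝ) * (d + 1) / 4 < D ∧ ∀ g, f g ≤ C * (1 + frobNorm g ^ 2) ^ (-D)

/-- The symmetric matrix `v vᵀ`. -/
def outerSym {d : ℕ} (v : EuclideanSpace ℝ (Fin d)) : SymMat d :=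
  ⟨Matrix.vecMulVec v v, Matrix.transpose_vecMulVec _ _⟩

/-- The rank-one model: `(a i, y i)`, `i < b`, are i.i.d. pairs in `ℝ^d × ℝ` and
`A = Id - (η / b) ∑ a_i a_iᵀ`, `B = (η / b) ∑ y_i a_i`. -/
structure Rank1 {Ω : Type*} [MeasurableSpace Ω] (P : Measure Ω) {d b : ℕ} (η : ℝ)
    (A : Ω → Matrix (Fin d) (Fin d) ℝ) (B : Ω → EuclideanSpace ℝ (Fin d))
    (a : Fin b → Ω → EuclideanSpace ℝ (Fin d)) (y : Fin b → Ω → ℝ) : Prop where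
  eta_pos : 0 < η
  indep : iIndepFun (fun i ω => (a i ω, y i ω)) P
  identDistrib : ∀ i j, IdentDistrib (fun ω => (a i ω, y i ω)) (fun ω => (a j ω, y j ω)) P P
  A_eq : ∀ ω, A ω = 1 - (η / b) • ∑ i, (outerSym (a i ω) : Matrix (Fin d) (Fin d) ℝ)
  B_eq : ∀ ω, B ω = (η / b) • ∑ i, y i ω • a i ω

/-- The Gaussian rank-one model: the rank-one model with `a_i ~ N(0, Id)` independent of
`y_i ~ N(0, 1)`. -/
structure Rank1Gauss {Ω : Type*} [MeasurableSpace Ω] (P : Measure Ω) {d b : ℕ} (η : ℝ)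
    (A : Ω → Matrix (Fin d) (Fin d) ℝ) (B : Ω → EuclideanSpace ℝ (Fin d))
    (a : Fin b → Ω → EuclideanSpace ℝ (Fin d)) (y : Fin b → Ω → ℝ) : Prop
    extends Rank1 P η A B a y where
  law_a : ∀ i, HasLaw (a i) (stdGaussian (EuclideanSpace ℝ (Fin d))) P
  law_y : ∀ i, HasLaw (y i) (gaussianReal 0 1) P
  indep_a_y : ∀ i, IndepFun (a i) (y i) P

/-! The standard Gaussian density is the bounded integrable weight `(√(2π))⁻¹ exp(-x²/4)` times
`exp(-x²/4)`. Over all entries of the `a_i` the second factors multiply to `exp(-tr H / 4)`, at most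
`exp(-|H| / 4)` because `|H| ≤ tr H`. So it is enough that `H` has bounded density when the `a_i`
are drawn from the first weight: the law of `H` is then at most `K exp(-|x| / 4) dx`, which beats
every power of `1 + |x|²` with one and the same density.

The bounded density comes from `d + 1` vectors, the critical number: the Wishart factor `det ^ ((n -
d - 1) / 2)` is trivial at `n = d + 1`. There the weight is at most Lebesgue measure, and
`exists_lintegral_gramUpper_le` bounds the image of Lebesgue measure under `X ↦ Xᵀ X` by induction
on `d`. A rotation sends the first column `v` to `‖v‖ e₀`. The Gram matrix then has corner `‖v‖²`,
first row `‖v‖ z` and block `z zᵀ` plus a Gram matrix of the previous size. Translation invariance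
absorbs `z zᵀ`, rescaling `z` costs `‖v‖⁻ᵈ`, and polar coordinates in dimension `d + 2` leave `r
dr`, half of `d(r²)`.

Each further independent vector adds an independent summand to `H`, and convolution with a finite
measure keeps a density bounded (`exists_lintegral_sum_outerUpper_le`). -/

/-! ### Densities of product measures. -/

theorem lintegral_fin_prod_eq_prod_lintegral {α : Type*} [MeasurableSpace α] (μ : Measure α)
    [SigmaFinite μ] (n : ℕ) (f : Fin n → α → ℝ≥0∞) (hf : ∀ i, Measurable (f i)) :
    ∫⁻ x, ∏ i, f i (x i) ∂Measure.pi (fun _ : Fin n => μ) = ∏ i, ∫⁻ x, f i x ∂μ := by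
  induction n with
  | zero => simp [lintegral_const]
  | succ n ih =>
    have hmp := (measurePreserving_piFinSuccAbove (fun _ : Fin (n + 1) => μ) 0).symm
    rw [← hmp.lintegral_comp_emb (MeasurableEquiv.measurableEmbedding _)]
    simp only [MeasurableEquiv.piFinSuccAbove_symm_apply, Fin.insertNthEquiv, Fin.prod_univ_succ,
      Equiv.coe_fn_mk, Fin.insertNth_zero', Fin.cons_zero, Fin.cons_succ]
    rw [lintegral_prod_mul (f := fun x => f 0 x)
      (g := fun x : Fin n → α => ∏ i : Fin n, f i.succ (x i)), ih _ fun i => hf _]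
    · exact (hf 0).aemeasurable
    · exact (Finset.measurable_fun_prod _ fun i _ =>
        (hf _).comp (measurable_pi_apply i)).aemeasurable

theorem pi_fin_withDensity {α : Type*} [MeasurableSpace α] (μ : Measure α) [SigmaFinite μ]
    (n : ℕ) {f : α → ℝ≥0∞} (hf : Measurable f) [SigmaFinite (μ.withDensity f)] :
    Measure.pi (fun _ : Fin n => μ.withDensity f) =
      (Measure.pi fun _ : Fin n => μ).withDensity fun x => ∏ i, f (x i) := by
  refine Measure.pi_eq fun s hs => ?_
  rw [withDensity_apply _ (MeasurableSet.univ_pi hs),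
    ← lintegral_indicator (MeasurableSet.univ_pi hs)]
  have h (x : Fin n → α) : (Set.univ.pi s).indicator (fun x => ∏ i, f (x i)) x =
      ∏ i, (s i).indicator f (x i) := by
    classical
    by_cases hx : x ∈ Set.univ.pi s
    · rw [Set.indicator_of_mem hx]
      exact Finset.prod_congr rfl fun i _ => (Set.indicator_of_mem (hx i trivial) f).symm
    · rw [Set.indicator_of_notMem hx]
      simp only [Set.mem_pi, Set.mem_univ, true_imp_iff, not_forall] at hx
      obtain ⟨i, hi⟩ := hx
      exact (Finset.prod_eq_zero (Finset.mem_univ i) (Set.indicator_of_notMem hi f)).symm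
  simp_rw [h]
  rw [lintegral_fin_prod_eq_prod_lintegral μ n _ fun i => hf.indicator (hs i)]
  refine Finset.prod_congr rfl fun i _ => ?_
  rw [lintegral_indicator (hs i), withDensity_apply _ (hs i)]

/-! ### Polar coordinates and scaling. -/

theorem lintegral_fun_norm_addHaar {E : Type*} [NormedAddCommGroup E] [NormedSpace ℝ E]
    [Nontrivial E] [FiniteDimensional ℝ E] [MeasurableSpace E] [BorelSpace E] (μ : Measure E)
    [μ.IsAddHaarMeasure] {f : ℝ → ℝ≥0∞} (hf : Measurable f) :
    ∫⁻ x, f ‖x‖ ∂μ = μ.toSphere Set.univ *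
      ∫⁻ r in Set.Ioi (0 : ℝ), ENNReal.ofReal (r ^ (Module.finrank ℝ E - 1)) * f r := by
  calc
    ∫⁻ x, f ‖x‖ ∂μ = ∫⁻ x : ({0}ᶜ : Set E), f ‖x.1‖ ∂(μ.comap (↑)) := by
      rw [lintegral_subtype_comap (measurableSet_singleton _).compl fun x => f ‖x‖,
        restrict_compl_singleton]
    _ = ∫⁻ x, f x.2 ∂μ.toSphere.prod (.volumeIoiPow (Module.finrank ℝ E - 1)) := by
      simpa using μ.measurePreserving_homeomorphUnitSphereProd.lintegral_comp_emb
        (Homeomorph.measurableEmbedding _) (f ∘ Subtype.val ∘ Prod.snd)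
    _ = μ.toSphere Set.univ *
        ∫⁻ x : Set.Ioi (0 : ℝ), f x ∂.volumeIoiPow (Module.finrank ℝ E - 1) := by
      rw [lintegral_prod _ (by fun_prop)]
      simp [mul_comm]
    _ = _ := by
      rw [Measure.volumeIoiPow, lintegral_withDensity_eq_lintegral_mul _ (by fun_prop)
        (by fun_prop)]
      rw [← lintegral_subtype_comap measurableSet_Ioi
        fun r => ENNReal.ofReal (r ^ (Module.finrank ℝ E - 1)) * f r]
      rfl

/-- The dimension `d + 2` is the one where the singular weight matches the radial Jacobian: `r ^ (d
+ 1) * r⁻¹ ^ d = r`, and `2 r dr = dt` for `t = r ^ 2`. `K` is the area of the unit sphere. -/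
theorem exists_lintegral_norm_inv_pow_mul_le (d : ℕ) : ∃ K : ℝ≥0∞, K ≠ ∞ ∧
    ∀ Φ : ℝ → ℝ≥0∞, Measurable Φ →
      ∫⁻ v : EuclideanSpace ℝ (Fin (d + 2)), ENNReal.ofReal ‖v‖⁻¹ ^ d * Φ (‖v‖ ^ 2) ≤
        K * ∫⁻ t, Φ t := by
  refine ⟨(volume : Measure (EuclideanSpace ℝ (Fin (d + 2)))).toSphere Set.univ,
    measure_ne_top _ _, fun Φ hΦ => ?_⟩
  rw [lintegral_fun_norm_addHaar (f := fun r => ENNReal.ofReal r⁻¹ ^ d * Φ (r ^ 2)) _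
    (by fun_prop)]
  refine mul_le_mul' le_rfl ?_
  calc
    _ ≤ ∫⁻ r in Set.Ioi (0 : ℝ), ENNReal.ofReal |2 * r| * Φ (r ^ 2) := by
      refine setLIntegral_mono' measurableSet_Ioi fun r hr => ?_
      have hr0 : (0 : ℝ) < r := hr
      rw [← mul_assoc, ← ENNReal.ofReal_pow (by positivity), ← ENNReal.ofReal_mul (by positivity)]
      gcongr
      rw [finrank_euclideanSpace_fin, abs_of_pos (by positivity), Nat.add_sub_cancel_right
        (n := d + 1) (m := 1), pow_succ, inv_pow, mul_right_comm, mul_inv_cancel₀ (by positivity)]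
      linarith
    _ = ∫⁻ t in (fun r : ℝ => r ^ 2) '' Set.Ioi 0, Φ t := by
      refine (lintegral_image_eq_lintegral_abs_deriv_mul measurableSet_Ioi (fun r _ => ?_)
        (fun r hr s hs h => ?_) Φ).symm
      · simpa using (hasDerivAt_pow 2 r).hasDerivWithinAt
      · exact (pow_left_inj₀ (le_of_lt hr) (le_of_lt hs) two_ne_zero).1 h
    _ ≤ ∫⁻ t, Φ t := setLIntegral_le_lintegral _ _

theorem lintegral_comp_smul_pi (d : ℕ) {c : ℝ} (hc : 0 < c) {F : (Fin d → ℝ) → ℝ≥0∞}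
    (hF : Measurable F) :
    ∫⁻ z, F (c • z) = ENNReal.ofReal c⁻¹ ^ d * ∫⁻ w, F w := by
  rw [← lintegral_map hF (by fun_prop), Measure.map_addHaar_smul _ hc.ne', lintegral_smul_measure,
    Module.finrank_fin_fun, abs_of_pos (by positivity), ← inv_pow,
    ENNReal.ofReal_pow (by positivity), smul_eq_mul]

/-! ### Bordered symmetric matrices in upper triangular coordinates. -/

theorem lintegral_sum_pi {ι κ : Type*} [Fintype ι] [Fintype κ] {F : (ι ⊕ κ → ℝ) → ℝ≥0∞}
    (hF : Measurable F) :
    ∫⁻ x, F x = ∫⁻ a : ι → ℝ, ∫⁻ b : κ → ℝ, F (Sum.elim a b) := by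
  have h := volume_measurePreserving_sumPiEquivProdPi_symm (fun _ : ι ⊕ κ => ℝ)
  rw [← h.lintegral_comp_emb (MeasurableEquiv.measurableEmbedding _), Measure.volume_eq_prod,
    lintegral_prod _ (by fun_prop)]
  refine lintegral_congr fun a => lintegral_congr fun b => congrArg F ?_
  ext (i | i) <;> rfl

theorem lintegral_pi_congr {ι κ : Type*} [Fintype ι] [Fintype κ] (e : ι ≃ κ)
    (F : (ι → ℝ) → ℝ≥0∞) :
    ∫⁻ x, F x = ∫⁻ y : κ → ℝ, F (y ∘ e) := by
  have h := (volume_measurePreserving_piCongrLeft (fun _ : κ => ℝ) e).symm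
  rw [← h.lintegral_comp_emb (MeasurableEquiv.measurableEmbedding _)]
  rfl

/-- The upper triangular positions of size `d + 1`: the corner, the rest of the first row, and the
upper triangular positions of size `d`. -/
def upperIdxSuccEquiv (d : ℕ) : UpperIdx (d + 1) ≃ Unit ⊕ (Fin d ⊕ UpperIdx d) where
  toFun p := Fin.cases (motive := fun i => ∀ j : Fin (d + 1), i ≤ j → _)
    (fun j _ => Fin.cases (Sum.inl ()) (fun j => Sum.inr (Sum.inl j)) j)
    (fun i j => Fin.cases (motive := fun j => i.succ ≤ j → _) (fun _ => Sum.inl ())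
      (fun j h => Sum.inr (Sum.inr ⟨(i, j), Fin.succ_le_succ_iff.1 h⟩)) j) p.1.1 p.1.2 p.2
  invFun := Sum.elim (fun _ => ⟨(0, 0), le_rfl⟩) (Sum.elim (fun j => ⟨(0, j.succ), Fin.zero_le _⟩)
    (fun p => ⟨(p.1.1.succ, p.1.2.succ), Fin.succ_le_succ_iff.2 p.2⟩))
  left_inv := by
    rintro ⟨⟨i, j⟩, h⟩
    induction i using Fin.cases with
    | zero => induction j using Fin.cases <;> rfl
    | succ i =>
      induction j using Fin.cases with
      | zero => exact absurd h (by simp)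
      | succ j => rfl
  right_inv := by rintro (_ | _ | _) <;> rfl

/-- The symmetric matrix with corner `t`, rest of the first row `w` and remaining block `S`, in
upper triangular coordinates. -/
def upperBordered {d : ℕ} (t : ℝ) (w : Fin d → ℝ) (S : UpperIdx d → ℝ) : UpperIdx (d + 1) → ℝ :=
  Sum.elim (fun _ => t) (Sum.elim w S) ∘ upperIdxSuccEquiv d

theorem measurable_upperBordered {d : ℕ} : Measurable fun q : ℝ × (Fin d → ℝ) × (UpperIdx d → ℝ) =>
    upperBordered q.1 q.2.1 q.2.2 := by
  refine measurable_pi_lambda _ fun p => ?_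
  simp only [upperBordered, Function.comp_apply]
  rcases upperIdxSuccEquiv d p with _ | _ | _ <;> simp only [Sum.elim_inl, Sum.elim_inr] <;> fun_prop

@[fun_prop]
theorem Measurable.upperBordered {α : Type*} [MeasurableSpace α] {d : ℕ} {t : α → ℝ}
    {w : α → Fin d → ℝ} {S : α → UpperIdx d → ℝ} (ht : Measurable t) (hw : Measurable w)
    (hS : Measurable S) : Measurable fun x => upperBordered (t x) (w x) (S x) :=
  measurable_upperBordered.comp (ht.prodMk (hw.prodMk hS))

theorem lintegral_upperBordered {d : ℕ} {F : (UpperIdx (d + 1) → ℝ) → ℝ≥0∞} (hF : Measurable F) :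
    ∫⁻ x, F x = ∫⁻ t : ℝ, ∫⁻ w : Fin d → ℝ, ∫⁻ S : UpperIdx d → ℝ, F (upperBordered t w S) := by
  have hm : Measurable fun y : Unit ⊕ (Fin d ⊕ UpperIdx d) → ℝ => F (y ∘ upperIdxSuccEquiv d) :=
    hF.comp (measurable_pi_lambda _ fun p => measurable_pi_apply _)
  rw [lintegral_pi_congr (upperIdxSuccEquiv d), lintegral_sum_pi hm,
    ← (volume_preserving_funUnique Unit ℝ).symm.lintegral_comp_emb
      (MeasurableEquiv.measurableEmbedding _)]
  refine lintegral_congr fun t => ?_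
  rw [lintegral_sum_pi (F := fun y => F (Sum.elim _ y ∘ upperIdxSuccEquiv d))]
  · rfl
  · refine hm.comp (measurable_pi_lambda _ ?_)
    rintro (_ | _) <;> simp only [Sum.elim_inl, Sum.elim_inr] <;> fun_prop

/-! ### Gram matrices of Lebesgue distributed vectors. -/

/-- The Gram matrix of a family of vectors, in upper triangular coordinates. -/
def gramUpper {d : ℕ} {ι : Type*} [Fintype ι] (X : Fin d → ι → ℝ) : UpperIdx d → ℝ :=
  fun p => X p.1.1 ⬝ᵥ X p.1.2

theorem measurable_gramUpper {d : ℕ} {ι : Type*} [Fintype ι] :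
    Measurable (gramUpper : (Fin d → ι → ℝ) → _) := by
  unfold gramUpper dotProduct
  fun_prop

theorem gramUpper_cons_cons {d n : ℕ} (c : ℝ) (z : Fin d → ℝ) (Y : Fin d → Fin n → ℝ) :
    gramUpper (Fin.cons (Fin.cons c 0) fun j => Fin.cons (z j) (Y j) :
      Fin (d + 1) → Fin (n + 1) → ℝ) =
      upperBordered (c ^ 2) (c • z) ((fun p => z p.1.1 * z p.1.2) + gramUpper Y) := by
  funext p
  obtain ⟨q, rfl⟩ := (upperIdxSuccEquiv d).symm.surjective p
  rcases q with _ | _ | _ <;>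
    simp [upperBordered, gramUpper, upperIdxSuccEquiv, dotProduct, Fin.sum_univ_succ, sq]

/-- Extend `‖v‖⁻¹ • v` to an orthonormal basis and let `T` take coordinates in it. -/
theorem exists_measurePreserving_rotation {n : ℕ} {v : EuclideanSpace ℝ (Fin (n + 1))}
    (hv : v ≠ 0) : ∃ T : (Fin (n + 1) → ℝ) → Fin (n + 1) → ℝ, MeasurePreserving T ∧
      (∀ x y, T x ⬝ᵥ T y = x ⬝ᵥ y) ∧ T v = Fin.cons ‖v‖ 0 := by
  have hv' : ‖v‖ ≠ 0 := norm_ne_zero_iff.2 hv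
  have hon : Orthonormal ℝ (({0} : Set (Fin (n + 1))).domRestrict fun _ => ‖v‖⁻¹ • v) := by
    refine ⟨fun i => ?_, fun i j hij => absurd (Subsingleton.elim i j) hij⟩
    rw [Set.domRestrict_apply, norm_smul, norm_inv, norm_norm, inv_mul_cancel₀ hv']
  obtain ⟨b, hb⟩ := hon.exists_orthonormalBasis_extension_of_card_eq (by simp)
  have hb0 : b 0 = ‖v‖⁻¹ • v := hb 0 rfl
  have hv0 : v = ‖v‖ • b 0 := by rw [hb0, smul_smul, mul_inv_cancel₀ hv', one_smul]
  refine ⟨fun x => b.repr (WithLp.toLp 2 x), ?_, fun x y => ?_, ?_⟩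
  · exact (PiLp.volume_preserving_ofLp _).comp
      (b.measurePreserving_repr.comp (PiLp.volume_preserving_toLp _))
  · have h := b.repr.inner_map_map (WithLp.toLp 2 y) (WithLp.toLp 2 x)
    simpa only [EuclideanSpace.inner_eq_star_dotProduct, star_trivial] using h
  · have h : b.repr v = ‖v‖ • EuclideanSpace.single 0 1 := by
      conv_lhs => rw [hv0]
      rw [map_smul, b.repr_self]
    funext i
    simp only [WithLp.toLp_ofLp, h]
    induction i using Fin.cases <;> simp

theorem lintegral_pi_fin_succ {α : Type*} [MeasurableSpace α] (μ : Measure α) [SigmaFinite μ]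
    (n : ℕ) {F : (Fin (n + 1) → α) → ℝ≥0∞} (hF : Measurable F) :
    ∫⁻ x, F x ∂Measure.pi (fun _ => μ) =
      ∫⁻ v, ∫⁻ Y, F (Fin.cons v Y) ∂Measure.pi (fun _ : Fin n => μ) ∂μ := by
  have h := (measurePreserving_piFinSuccAbove (fun _ : Fin (n + 1) => μ) 0).symm
  rw [← h.lintegral_comp_emb (MeasurableEquiv.measurableEmbedding _),
    lintegral_prod _ (by fun_prop)]
  simp [MeasurableEquiv.piFinSuccAbove_symm_apply, Fin.insertNthEquiv]

theorem lintegral_pi_cons {d n : ℕ} {F : (Fin d → Fin (n + 1) → ℝ) → ℝ≥0∞} (hF : Measurable F) :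
    ∫⁻ X, F X = ∫⁻ z : Fin d → ℝ, ∫⁻ Y : Fin d → Fin n → ℝ, F fun j => Fin.cons (z j) (Y j) := by
  have h := (volume_preserving_pi fun _ : Fin d =>
      (volume_preserving_piFinSuccAbove (fun _ : Fin (n + 1) => ℝ) 0).symm).comp
    (volume_measurePreserving_arrowProdEquivProdArrow ℝ (Fin n → ℝ) (Fin d)).symm
  rw [← h.lintegral_comp hF, Measure.volume_eq_prod,
    lintegral_prod (fun q => F _) (hF.comp h.measurable).aemeasurable]
  refine lintegral_congr fun z => lintegral_congr fun Y => congrArg F ?_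
  funext j i
  induction i using Fin.cases <;> rfl

theorem lintegral_ofLp {ι : Type*} [Fintype ι] (G : (ι → ℝ) → ℝ≥0∞) :
    ∫⁻ v : EuclideanSpace ℝ ι, G v.ofLp = ∫⁻ v, G v :=
  (PiLp.volume_preserving_ofLp ι).lintegral_comp_emb
    (MeasurableEquiv.toLp 2 (ι → ℝ)).symm.measurableEmbedding G

/-- The inductive step with the first vector frozen. Applying the rotation to every vector changes
neither the Gram matrix nor Lebesgue measure. -/
theorem lintegral_gramUpper_cons_le {d : ℕ} {K : ℝ≥0∞} (hKtop : K ≠ ∞)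
    (hK : ∀ φ : (UpperIdx d → ℝ) → ℝ≥0∞, Measurable φ →
      ∫⁻ X : Fin d → Fin (d + 1) → ℝ, φ (gramUpper X) ≤ K * ∫⁻ S, φ S)
    {φ : (UpperIdx (d + 1) → ℝ) → ℝ≥0∞} (hφ : Measurable φ)
    {v : EuclideanSpace ℝ (Fin (d + 2))} (hv : v ≠ 0) :
    ∫⁻ Y : Fin d → Fin (d + 2) → ℝ, φ (gramUpper (Fin.cons v.ofLp Y : Fin (d + 1) → _)) ≤
      K * (ENNReal.ofReal ‖v‖⁻¹ ^ d *
        ∫⁻ w : Fin d → ℝ, ∫⁻ S : UpperIdx d → ℝ, φ (upperBordered (‖v‖ ^ 2) w S)) := by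
  obtain ⟨T, hT, hdot, hTv⟩ := exists_measurePreserving_rotation hv
  have hgram (Y : Fin d → Fin (d + 2) → ℝ) :
      gramUpper (Fin.cons v.ofLp Y : Fin (d + 1) → _) =
        gramUpper (Fin.cons (Fin.cons ‖v‖ 0) fun j => T (Y j) : Fin (d + 1) → _) := by
    have h : (Fin.cons (Fin.cons ‖v‖ 0) fun j => T (Y j) : Fin (d + 1) → Fin (d + 2) → ℝ) =
        fun j => T ((Fin.cons v.ofLp Y : Fin (d + 1) → Fin (d + 2) → ℝ) j) := by
      funext j
      induction j using Fin.cases <;> simp [hTv]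
    funext p
    simp only [h, gramUpper, hdot]
  have hcons : Measurable fun Y : Fin d → Fin (d + 2) → ℝ =>
      φ (gramUpper (Fin.cons (Fin.cons ‖v‖ 0) Y : Fin (d + 1) → _)) := by
    refine hφ.comp (measurable_gramUpper.comp (measurable_pi_lambda _ fun j => ?_))
    induction j using Fin.cases <;> simp only [Fin.cons_zero, Fin.cons_succ] <;> fun_prop
  have hF : Measurable fun q : (Fin d → ℝ) × (UpperIdx d → ℝ) =>
      φ (upperBordered (‖v‖ ^ 2) q.1 q.2) := by fun_prop
  calc
    _ = ∫⁻ Y : Fin d → Fin (d + 2) → ℝ,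
        φ (gramUpper (Fin.cons (Fin.cons ‖v‖ 0) Y : Fin (d + 1) → _)) := by
      simp_rw [hgram]
      exact (volume_preserving_pi fun _ : Fin d => hT).lintegral_comp hcons
    _ = ∫⁻ z : Fin d → ℝ, ∫⁻ Y : Fin d → Fin (d + 1) → ℝ,
        φ (upperBordered (‖v‖ ^ 2) (‖v‖ • z) ((fun p => z p.1.1 * z p.1.2) + gramUpper Y)) := by
      rw [lintegral_pi_cons hcons]
      simp_rw [gramUpper_cons_cons]
    -- For fixed `z` the term `z zᵀ` is a translation of `S`, invisible to Lebesgue measure.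
    _ ≤ ∫⁻ z : Fin d → ℝ, K * ∫⁻ S, φ (upperBordered (‖v‖ ^ 2) (‖v‖ • z) S) := by
      refine lintegral_mono fun z => ?_
      refine (hK (fun S => φ (upperBordered (‖v‖ ^ 2) (‖v‖ • z)
        ((fun p => z p.1.1 * z p.1.2) + S))) (by fun_prop)).trans_eq ?_
      rw [lintegral_add_left_eq_self fun S => φ (upperBordered (‖v‖ ^ 2) (‖v‖ • z) S)]
    _ = _ := by
      rw [lintegral_const_mul' _ _ hKtop,
        lintegral_comp_smul_pi d (norm_pos_iff.2 hv) hF.lintegral_prod_right']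

/-- The image of Lebesgue measure on `(d + 1) × d` matrices under `X ↦ Xᵀ X` is bounded by a
multiple of Lebesgue measure. -/
theorem exists_lintegral_gramUpper_le (d : ℕ) : ∃ K : ℝ≥0∞, K ≠ ∞ ∧
    ∀ φ : (UpperIdx d → ℝ) → ℝ≥0∞, Measurable φ →
      ∫⁻ X : Fin d → Fin (d + 1) → ℝ, φ (gramUpper X) ≤ K * ∫⁻ S, φ S := by
  induction d with
  | zero =>
    refine ⟨1, ENNReal.one_ne_top, fun φ _ => ?_⟩
    have : IsEmpty (UpperIdx 0) := ⟨fun p => p.1.1.elim0⟩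
    simp only [Subsingleton.elim (gramUpper _) (0 : UpperIdx 0 → ℝ), lintegral_unique,
      volume_pi, Measure.pi_empty_univ, mul_one, one_mul]
    exact (congrArg φ (Subsingleton.elim _ _)).le
  | succ d ih =>
    obtain ⟨K, hKtop, hK⟩ := ih
    obtain ⟨L, hLtop, hL⟩ := exists_lintegral_norm_inv_pow_mul_le d
    refine ⟨K * L, ENNReal.mul_ne_top hKtop hLtop, fun φ hφ => ?_⟩
    have hΦ : Measurable fun t : ℝ => ∫⁻ w : Fin d → ℝ, ∫⁻ S : UpperIdx d → ℝ,
        φ (upperBordered t w S) := by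
      refine Measurable.lintegral_prod_right' (f := fun q : ℝ × (Fin d → ℝ) =>
        ∫⁻ S : UpperIdx d → ℝ, φ (upperBordered q.1 q.2 S)) ?_
      exact Measurable.lintegral_prod_right' (f := fun q : (ℝ × (Fin d → ℝ)) × (UpperIdx d → ℝ) =>
        φ (upperBordered q.1.1 q.1.2 q.2)) (by fun_prop)
    calc
      _ = ∫⁻ v : Fin (d + 2) → ℝ, ∫⁻ Y : Fin d → Fin (d + 2) → ℝ,
          φ (gramUpper (Fin.cons v Y : Fin (d + 1) → _)) :=
        lintegral_pi_fin_succ (volume : Measure (Fin (d + 2) → ℝ)) d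
          (F := fun X => φ (gramUpper X)) (hφ.comp measurable_gramUpper)
      _ = ∫⁻ v : EuclideanSpace ℝ (Fin (d + 2)), ∫⁻ Y : Fin d → Fin (d + 2) → ℝ,
          φ (gramUpper (Fin.cons v.ofLp Y : Fin (d + 1) → _)) :=
        (lintegral_ofLp _).symm
      _ ≤ ∫⁻ v : EuclideanSpace ℝ (Fin (d + 2)), K * (ENNReal.ofReal ‖v‖⁻¹ ^ d *
          ∫⁻ w : Fin d → ℝ, ∫⁻ S : UpperIdx d → ℝ, φ (upperBordered (‖v‖ ^ 2) w S)) := by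
        refine lintegral_mono_ae ?_
        filter_upwards [Measure.ae_ne volume (0 : EuclideanSpace ℝ (Fin (d + 2)))] with v hv
        exact lintegral_gramUpper_cons_le hKtop hK hφ hv
      _ ≤ K * L * ∫⁻ S, φ S := by
        rw [lintegral_const_mul' _ _ hKtop, mul_assoc, lintegral_upperBordered hφ]
        exact mul_le_mul' le_rfl (hL _ hΦ)

/-! ### Sums of at least `d + 1` rank-one matrices. -/

/-- Passes between `n` samples in `ℝ^d`, as in the model, and `d` columns in `ℝ^n`, whose Gram
matrix is the same sum. -/
theorem lintegral_pi_swap {d n : ℕ} {F : (Fin n → Fin d → ℝ) → ℝ≥0∞} (hF : Measurable F) :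
    ∫⁻ X, F X = ∫⁻ Y : Fin d → Fin n → ℝ, F fun i j => Y j i := by
  induction n with
  | zero =>
    simp only [lintegral_unique, volume_pi, Measure.pi_univ, Finset.univ_eq_empty,
      Finset.prod_empty, Finset.prod_const_one, mul_one]
    exact congrArg F (Subsingleton.elim _ _)
  | succ n ih =>
    rw [lintegral_pi_cons (F := fun Y : Fin d → Fin (n + 1) → ℝ => F fun i j => Y j i)
      (by fun_prop)]
    refine (lintegral_pi_fin_succ (volume : Measure (Fin d → ℝ)) n hF).trans ?_
    refine lintegral_congr fun z => ?_
    refine (ih (F := fun X => F (Fin.cons z X)) ?_).trans ?_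
    · refine hF.comp (measurable_pi_lambda _ fun i => ?_)
      induction i using Fin.cases <;> simp only [Fin.cons_zero, Fin.cons_succ] <;> fun_prop
    · refine lintegral_congr fun Y => congrArg F ?_
      funext i j
      induction i using Fin.cases <;> rfl

/-- The symmetric matrix `v vᵀ` in upper triangular coordinates. -/
def outerUpper {d : ℕ} (v : Fin d → ℝ) : UpperIdx d → ℝ := fun p => v p.1.1 * v p.1.2

theorem measurable_outerUpper {d : ℕ} : Measurable (outerUpper (d := d)) := by
  unfold outerUpper
  fun_prop

theorem measurable_sum_outerUpper {d n : ℕ} :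
    Measurable fun X : Fin n → Fin d → ℝ => ∑ i, outerUpper (X i) :=
  Finset.measurable_fun_sum _ fun i _ => measurable_outerUpper.comp (measurable_pi_apply i)

theorem gramUpper_eq_sum_outerUpper {d n : ℕ} (Y : Fin d → Fin n → ℝ) :
    gramUpper Y = ∑ i, outerUpper fun j => Y j i := by
  funext p
  simp [gramUpper, outerUpper, dotProduct]

/-- If the `(d + 1)`-st power of a finite measure on `ℝ^d` is bounded by Lebesgue measure then
`∑ i, v_i v_iᵀ` has bounded density for at least `d + 1` independent vectors `v_i` distributed
according to it. -/
theorem exists_lintegral_sum_outerUpper_le {d n : ℕ} (hn : d + 1 ≤ n) (ρ : Measure (Fin d → ℝ))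
    [IsFiniteMeasure ρ]
    (hρ : Measure.pi (fun _ : Fin (d + 1) => ρ) ≤ volume) : ∃ K : ℝ≥0∞, K ≠ ∞ ∧
    ∀ φ : (UpperIdx d → ℝ) → ℝ≥0∞, Measurable φ →
      ∫⁻ X, φ (∑ i, outerUpper (X i)) ∂Measure.pi (fun _ : Fin n => ρ) ≤ K * ∫⁻ S, φ S := by
  induction n, hn using Nat.le_induction with
  | base =>
    obtain ⟨K, hKtop, hK⟩ := exists_lintegral_gramUpper_le d
    refine ⟨K, hKtop, fun φ hφ => ?_⟩
    refine (lintegral_mono' hρ le_rfl).trans ?_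
    rw [lintegral_pi_swap (F := fun X => φ (∑ i, outerUpper (X i)))
      (hφ.comp measurable_sum_outerUpper)]
    simp_rw [← gramUpper_eq_sum_outerUpper]
    exact hK φ hφ
  | succ n hn ih =>
    obtain ⟨K, hKtop, hK⟩ := ih
    -- Conditionally on the new vector the sum is only translated, so integrating it out costs the
    -- total mass of `ρ`; Lebesgue measure itself would give an infinite constant.
    refine ⟨K * ρ Set.univ, ENNReal.mul_ne_top hKtop (measure_ne_top _ _), fun φ hφ => ?_⟩
    rw [lintegral_pi_fin_succ ρ n (F := fun X => φ (∑ i, outerUpper (X i)))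
      (hφ.comp measurable_sum_outerUpper)]
    calc
      _ ≤ ∫⁻ _, (K * ∫⁻ S, φ S) ∂ρ := by
        refine lintegral_mono fun v => ?_
        simp only [Fin.sum_univ_succ, Fin.cons_zero, Fin.cons_succ]
        refine (hK (fun S => φ (outerUpper v + S)) (by fun_prop)).trans_eq ?_
        rw [lintegral_add_left_eq_self]
      _ = K * ρ Set.univ * ∫⁻ S, φ S := by rw [lintegral_const, mul_right_comm]

/-! ### Splitting the Gaussian and the exponential bound. -/

/-- A finite multiple of the centred Gaussian law of variance `2`, which is bounded by Lebesgue
measure and dominates the standard Gaussian law with Gaussian weight. -/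
noncomputable def wideGaussian : Measure ℝ :=
  volume.withDensity fun x => ENNReal.ofReal ((√(2 * Real.pi))⁻¹ * Real.exp (-(1 / 4) * x ^ 2))

instance : IsFiniteMeasure wideGaussian := by
  refine isFiniteMeasure_withDensity_ofReal ?_
  exact ((integrable_exp_neg_mul_sq (by norm_num : (0 : ℝ) < 1 / 4)).const_mul _).2

theorem gaussianReal_eq_wideGaussian_withDensity :
    gaussianReal 0 1 =
      wideGaussian.withDensity fun x => ENNReal.ofReal (Real.exp (-(1 / 4) * x ^ 2)) := by
  rw [gaussianReal_of_var_ne_zero _ one_ne_zero, wideGaussian,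
    ← withDensity_mul _ (by fun_prop) (by fun_prop)]
  congr 1
  funext x
  rw [Pi.mul_apply, ← ENNReal.ofReal_mul (by positivity), mul_assoc, ← Real.exp_add, gaussianPDF,
    gaussianPDFReal]
  congr 3
  · simp
  · simp
    ring

theorem pi_pi_wideGaussian_le (d n : ℕ) :
    Measure.pi (fun _ : Fin n => Measure.pi fun _ : Fin d => wideGaussian) ≤ volume := by
  have hone (x : ℝ) :
      ENNReal.ofReal ((√(2 * Real.pi))⁻¹ * Real.exp (-(1 / 4) * x ^ 2)) ≤ 1 := by
    rw [ENNReal.ofReal_le_one]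
    refine mul_le_one₀ (inv_le_one_of_one_le₀ ?_) (Real.exp_nonneg _)
      (Real.exp_le_one_iff.2 (by nlinarith [sq_nonneg x]))
    exact Real.one_le_sqrt.2 (by linarith [Real.pi_gt_three])
  have hm : Measurable fun x : ℝ =>
      ENNReal.ofReal ((√(2 * Real.pi))⁻¹ * Real.exp (-(1 / 4) * x ^ 2)) := by fun_prop
  have h1 : Measure.pi (fun _ : Fin d => wideGaussian) = (volume : Measure (Fin d → ℝ)).withDensity
      fun v => ∏ j, ENNReal.ofReal ((√(2 * Real.pi))⁻¹ * Real.exp (-(1 / 4) * v j ^ 2)) := by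
    have : SigmaFinite (volume.withDensity fun x : ℝ =>
      ENNReal.ofReal ((√(2 * Real.pi))⁻¹ * Real.exp (-(1 / 4) * x ^ 2))) :=
      inferInstanceAs (SigmaFinite wideGaussian)
    exact pi_fin_withDensity volume d hm
  have : SigmaFinite ((volume : Measure (Fin d → ℝ)).withDensity
      fun v => ∏ j, ENNReal.ofReal ((√(2 * Real.pi))⁻¹ * Real.exp (-(1 / 4) * v j ^ 2))) :=
    h1 ▸ inferInstance
  rw [h1, pi_fin_withDensity volume n (by fun_prop)]
  conv_rhs => rw [← withDensity_one (μ := (volume : Measure (Fin n → Fin d → ℝ)))]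
  exact withDensity_mono (ae_of_all _ fun X => Finset.prod_le_one' fun i _ =>
    Finset.prod_le_one' fun j _ => hone (X i j))

theorem pi_pi_gaussianReal_eq (d n : ℕ) :
    Measure.pi (fun _ : Fin n => Measure.pi fun _ : Fin d => gaussianReal 0 1) =
      (Measure.pi fun _ : Fin n => Measure.pi fun _ : Fin d => wideGaussian).withDensity fun X =>
        ENNReal.ofReal (Real.exp (-(1 / 4) * ∑ i, ∑ j, X i j ^ 2)) := by
  have hm : Measurable fun x : ℝ => ENNReal.ofReal (Real.exp (-(1 / 4) * x ^ 2)) := by fun_prop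
  have h1 : Measure.pi (fun _ : Fin d => gaussianReal 0 1) =
      (Measure.pi fun _ : Fin d => wideGaussian).withDensity
        fun v => ∏ j, ENNReal.ofReal (Real.exp (-(1 / 4) * v j ^ 2)) := by
    have : SigmaFinite (wideGaussian.withDensity fun x : ℝ =>
        ENNReal.ofReal (Real.exp (-(1 / 4) * x ^ 2))) :=
      gaussianReal_eq_wideGaussian_withDensity ▸ inferInstance
    rw [gaussianReal_eq_wideGaussian_withDensity]
    exact pi_fin_withDensity _ d hm
  have : SigmaFinite ((Measure.pi fun _ : Fin d => wideGaussian).withDensity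
      fun v => ∏ j, ENNReal.ofReal (Real.exp (-(1 / 4) * v j ^ 2))) :=
    h1 ▸ inferInstance
  rw [h1, pi_fin_withDensity _ n (by fun_prop)]
  congr 1
  funext X
  simp_rw [← ENNReal.ofReal_prod_of_nonneg fun j _ => Real.exp_nonneg _]
  rw [← ENNReal.ofReal_prod_of_nonneg fun i _ => Finset.prod_nonneg fun j _ => Real.exp_nonneg _]
  simp_rw [← Real.exp_sum, ← Finset.mul_sum]

/-- The upper entries are some of the entries of `v vᵀ`, whose Frobenius norm is `|v|²`. -/
theorem norm_outerUpper_le {d : ℕ} (v : Fin d → ℝ) :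
    ‖(WithLp.toLp 2 (outerUpper v) : UpperVec d)‖ ≤ ∑ j, v j ^ 2 := by
  rw [EuclideanSpace.norm_eq]
  refine Real.sqrt_le_iff.2 ⟨Finset.sum_nonneg fun j _ => sq_nonneg _, ?_⟩
  calc
    _ = ∑ p : UpperIdx d, (v p.1.1 * v p.1.2) ^ 2 := by
      simp only [outerUpper, Real.norm_eq_abs, sq_abs]
    _ ≤ ∑ p : Fin d × Fin d, (v p.1 * v p.2) ^ 2 := by
      refine (Finset.sum_map Finset.univ (Function.Embedding.subtype _)
        fun p : Fin d × Fin d => (v p.1 * v p.2) ^ 2).symm.trans_le ?_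
      exact Finset.sum_le_sum_of_subset_of_nonneg (Finset.subset_univ _)
        fun _ _ _ => sq_nonneg _
    _ = (∑ j, v j ^ 2) ^ 2 := by
      simp_rw [Fintype.sum_prod_type, mul_pow, sq (∑ j, v j ^ 2), Finset.sum_mul_sum]

theorem norm_sum_outerUpper_le {d n : ℕ} (X : Fin n → Fin d → ℝ) :
    ‖(WithLp.toLp 2 (∑ i, outerUpper (X i)) : UpperVec d)‖ ≤ ∑ i, ∑ j, X i j ^ 2 := by
  rw [WithLp.toLp_sum]
  exact (norm_sum_le _ _).trans (Finset.sum_le_sum fun i _ => norm_outerUpper_le (X i))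

theorem exists_lintegral_pi_gaussianReal_le {d n : ℕ} (hn : d + 1 ≤ n) : ∃ K : ℝ≥0∞, K ≠ ∞ ∧
    ∀ φ : UpperVec d → ℝ≥0∞, Measurable φ →
      ∫⁻ X, φ (WithLp.toLp 2 (∑ i, outerUpper (X i)))
          ∂Measure.pi (fun _ : Fin n => Measure.pi fun _ : Fin d => gaussianReal 0 1) ≤
        K * ∫⁻ S, φ S * ENNReal.ofReal (Real.exp (-(1 / 4) * ‖S‖)) := by
  obtain ⟨K, hKtop, hK⟩ := exists_lintegral_sum_outerUpper_le hn
    (Measure.pi fun _ : Fin d => wideGaussian) (pi_pi_wideGaussian_le d _)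
  refine ⟨K, hKtop, fun φ hφ => ?_⟩
  have hm : Measurable fun X : Fin n → Fin d → ℝ =>
      φ (WithLp.toLp 2 (∑ i, outerUpper (X i))) :=
    hφ.comp ((by fun_prop : Measurable (WithLp.toLp 2 : (UpperIdx d → ℝ) → UpperVec d)).comp
      measurable_sum_outerUpper)
  rw [pi_pi_gaussianReal_eq, lintegral_withDensity_eq_lintegral_mul _ (by fun_prop) hm]
  calc
    _ ≤ ∫⁻ X, φ (WithLp.toLp 2 (∑ i, outerUpper (X i))) * ENNReal.ofReal (Real.exp
          (-(1 / 4) * ‖(WithLp.toLp 2 (∑ i, outerUpper (X i)) : UpperVec d)‖))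
        ∂Measure.pi (fun _ : Fin n => Measure.pi fun _ : Fin d => wideGaussian) := by
      refine lintegral_mono fun X => ?_
      rw [Pi.mul_apply, mul_comm]
      exact mul_le_mul' le_rfl (ENNReal.ofReal_le_ofReal (Real.exp_le_exp.2
        (mul_le_mul_of_nonpos_left (norm_sum_outerUpper_le X) (by norm_num))))
    _ ≤ K * ∫⁻ S : UpperIdx d → ℝ, φ (WithLp.toLp 2 S) *
        ENNReal.ofReal (Real.exp (-(1 / 4) * ‖(WithLp.toLp 2 S : UpperVec d)‖)) :=
      hK (fun S => φ (WithLp.toLp 2 S) *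
        ENNReal.ofReal (Real.exp (-(1 / 4) * ‖(WithLp.toLp 2 S : UpperVec d)‖))) (by fun_prop)
    _ = _ := by rw [← lintegral_ofLp]

/-- Bound `1 + r ^ 2` by `(1 + r) ^ 2`, then apply `x ≤ exp x` at `x = (1 + r) / (8 * D)`. The scale
`8 * D` makes the power `2 * D` equal to `exp ((1 + r) / 4)`, which cancels the decay up to `exp (1
/ 4)`. -/
theorem exp_neg_mul_le_one_add_sq_rpow {D : ℝ} (hD : 0 < D) {r : ℝ} (hr : 0 ≤ r) :
    Real.exp (-(1 / 4) * r) ≤ (8 * D) ^ (2 * D) * Real.exp (1 / 4) * (1 + r ^ 2) ^ (-D) := by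
  have hpos : 0 < 1 + r ^ 2 := by positivity
  have hlin : 1 + r ≤ 8 * D * Real.exp ((1 + r) / (8 * D)) := by
    have h := Real.add_one_le_exp ((1 + r) / (8 * D))
    calc
      1 + r = 8 * D * ((1 + r) / (8 * D)) := by field_simp
      _ ≤ _ := by gcongr; linarith
  rw [Real.rpow_neg hpos.le, ← div_eq_mul_inv, le_div_iff₀ (Real.rpow_pos_of_pos hpos D)]
  calc
    _ ≤ Real.exp (-(1 / 4) * r) * (1 + r) ^ (2 * D) := by
      gcongr
      rw [Real.rpow_mul (by positivity), Real.rpow_two]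
      exact Real.rpow_le_rpow hpos.le (by nlinarith) hD.le
    _ ≤ Real.exp (-(1 / 4) * r) * (8 * D * Real.exp ((1 + r) / (8 * D))) ^ (2 * D) := by
      gcongr
    _ = _ := by
      rw [Real.mul_rpow (by positivity) (Real.exp_nonneg _), ← Real.exp_mul, mul_left_comm,
        ← Real.exp_add]
      congr 2
      field_simp
      ring

/-! ### Extracting a density and moving it to symmetric matrices. -/

theorem exists_hasDensity_le {Ω E : Type*} [MeasurableSpace Ω] [MeasurableSpace E] {P : Measure Ω}
    [IsFiniteMeasure P] {ν : Measure E} [SigmaFinite ν] {X : Ω → E} (hX : AEMeasurable X P)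
    {g : E → ℝ} (hg : Measurable g) (hg0 : ∀ x, 0 ≤ g x)
    (h : P.map X ≤ ν.withDensity fun x => ENNReal.ofReal (g x)) :
    ∃ f : E → ℝ, HasDensity X P ν f ∧ ∀ x, f x ≤ g x := by
  have hac : P.map X ≪ ν := h.absolutelyContinuous.trans (withDensity_absolutelyContinuous _ _)
  have hle : (P.map X).rnDeriv ν ≤ᵐ[ν] fun x => ENNReal.ofReal (g x) := by
    refine ae_le_of_forall_setLIntegral_le_of_sigmaFinite (Measure.measurable_rnDeriv _ _)
      fun s hs _ => ?_
    rw [← withDensity_apply _ hs, Measure.withDensity_rnDeriv_eq _ _ hac, ← withDensity_apply _ hs]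
    exact h s
  -- The Radon–Nikodym derivative is below `g` only almost everywhere; the minimum makes the bound
  -- hold everywhere without changing the measure.
  refine ⟨fun x => min ((P.map X).rnDeriv ν x).toReal (g x),
    ⟨(Measure.measurable_rnDeriv _ _).ennreal_toReal.min hg,
      fun x => le_min ENNReal.toReal_nonneg (hg0 x), hX, ?_⟩, fun x => min_le_right _ _⟩
  refine (Measure.withDensity_rnDeriv_eq _ _ hac).symm.trans (withDensity_congr_ae ?_)
  filter_upwards [hle] with x hx
  rw [min_eq_left (ENNReal.toReal_le_of_le_ofReal (hg0 x) hx),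
    ENNReal.ofReal_toReal (ne_top_of_le_ne_top ENNReal.ofReal_ne_top hx)]

theorem HasDensity.of_symVec {Ω : Type*} [MeasurableSpace Ω] {P : Measure Ω} {d : ℕ}
    {H : Ω → SymMat d} {f : UpperVec d → ℝ} (h : HasDensity (fun ω => symVec d (H ω)) P volume f) :
    HasDensity H P (lebesgueSym d) fun g => f (symVec d g) := by
  have hs : Measurable (symVec d) := (symVec d).continuous.measurable
  have hi : Measurable (symVec d).symm := (symVec d).symm.continuous.measurable
  have hH : H = fun ω => (symVec d).symm (symVec d (H ω)) := by simp
  refine ⟨h.measurable.comp hs, fun g => h.nonneg _, ?_, ?_⟩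
  · rw [hH]
    exact hi.comp_aemeasurable h.hasLaw.aemeasurable
  · have hmap : P.map H = (P.map fun ω => symVec d (H ω)).map (symVec d).symm := by
      rw [AEMeasurable.map_map_of_aemeasurable hi.aemeasurable h.hasLaw.aemeasurable]
      exact congrArg P.map hH
    rw [hmap, h.hasLaw.map_eq]
    ext s hs'
    rw [Measure.map_apply hi hs', withDensity_apply _ (hi hs'), withDensity_apply _ hs',
      lebesgueSym, setLIntegral_map (f := fun g => ENNReal.ofReal (f (symVec d g))) hs'
        (h.measurable.comp hs).ennreal_ofReal hi]
    simp

/-- By symmetry the entries with `i ≤ j` and those with `j ≤ i` have the same sum of squares, and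
together they cover the matrix. -/
theorem frobNorm_sq_le {d : ℕ} (g : SymMat d) : frobNorm g ^ 2 ≤ 2 * ‖symVec d g‖ ^ 2 := by
  have hsymm (i j : Fin d) : (g : Matrix (Fin d) (Fin d) ℝ) i j = (g : Matrix _ _ ℝ) j i :=
    g.2.apply j i
  have hF : frobNorm g ^ 2 = ∑ p : Fin d × Fin d, (g : Matrix (Fin d) (Fin d) ℝ) p.1 p.2 ^ 2 := by
    rw [frobNorm, Matrix.frobenius_norm_def, ← Real.sqrt_eq_rpow, Real.sq_sqrt (by positivity),
      Fintype.sum_prod_type]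
    simp
  have hU : ‖symVec d g‖ ^ 2 =
      ∑ p : Fin d × Fin d with p.1 ≤ p.2, (g : Matrix (Fin d) (Fin d) ℝ) p.1 p.2 ^ 2 := by
    rw [EuclideanSpace.real_norm_sq_eq]
    exact (Finset.sum_subtype _ (by simp) fun p : Fin d × Fin d =>
      (g : Matrix (Fin d) (Fin d) ℝ) p.1 p.2 ^ 2).symm
  have hL : ‖symVec d g‖ ^ 2 =
      ∑ p : Fin d × Fin d with p.2 ≤ p.1, (g : Matrix (Fin d) (Fin d) ℝ) p.1 p.2 ^ 2 := by
    rw [hU]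
    refine Finset.sum_equiv (Equiv.prodComm _ _) (by simp) fun p _ => ?_
    rw [hsymm]
    rfl
  calc
    _ ≤ ‖symVec d g‖ ^ 2 + ‖symVec d g‖ ^ 2 := by
      nth_rw 2 [hL]
      rw [hF, hU, Finset.sum_filter, Finset.sum_filter, ← Finset.sum_add_distrib]
      refine Finset.sum_le_sum fun p _ => ?_
      have h0 := sq_nonneg ((g : Matrix (Fin d) (Fin d) ℝ) p.1 p.2)
      rcases le_total p.1 p.2 with h | h
      · rw [if_pos h]
        exact le_add_of_nonneg_right (by split_ifs <;> simp [h0])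
      · rw [if_pos h]
        exact le_add_of_nonneg_left (by split_ifs <;> simp [h0])
    _ = _ := (two_mul _).symm

/-! ### The Gaussian rank-one model. -/

theorem map_ofLp_eq_pi {Ω : Type*} [MeasurableSpace Ω] {P : Measure Ω} [IsProbabilityMeasure P]
    {d b : ℕ} {η : ℝ} {A : Ω → Matrix (Fin d) (Fin d) ℝ} {B : Ω → EuclideanSpace ℝ (Fin d)}
    {a : Fin b → Ω → EuclideanSpace ℝ (Fin d)} {y : Fin b → Ω → ℝ}
    (h : Rank1Gauss P η A B a y) :
    P.map (fun ω i => (a i ω).ofLp) =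
      Measure.pi fun _ : Fin b => Measure.pi fun _ : Fin d => gaussianReal 0 1 := by
  have hofLp : Measurable (WithLp.ofLp : EuclideanSpace ℝ (Fin d) → Fin d → ℝ) := by fun_prop
  have hind : iIndepFun (fun i ω => (a i ω).ofLp) P :=
    h.indep.comp (fun _ q => q.1.ofLp) fun _ => hofLp.comp measurable_fst
  refine (hind.map_fun_eq_pi_map
    fun i => hofLp.comp_aemeasurable (h.law_a i).aemeasurable).trans ?_
  congr 1
  funext i
  rw [← AEMeasurable.map_map_of_aemeasurable hofLp.aemeasurable (h.law_a i).aemeasurable,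
    (h.law_a i).map_eq, ← map_pi_eq_stdGaussian, Measure.map_map hofLp (by fun_prop)]
  exact Measure.map_id

theorem symVec_sum_outerSym {d b : ℕ} (v : Fin b → EuclideanSpace ℝ (Fin d)) :
    symVec d (∑ i, outerSym (v i)) = WithLp.toLp 2 (∑ i, outerUpper (v i).ofLp) := by
  ext p
  simp [symVec, outerUpper, outerSym, Matrix.sum_apply, Matrix.vecMulVec_apply]

/-- The law of `∑ i, a_i a_iᵀ` has a density with exponential decay. -/
theorem exists_hasDensity_symVec_le (d b : ℕ) (hb : d + 1 ≤ b) :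
    ∃ K : ℝ, 0 ≤ K ∧ ∀ {Ω : Type*} [MeasurableSpace Ω] (P : Measure Ω) [IsProbabilityMeasure P]
      (η : ℝ) (A : Ω → Matrix (Fin d) (Fin d) ℝ) (B : Ω → EuclideanSpace ℝ (Fin d))
      (a : Fin b → Ω → EuclideanSpace ℝ (Fin d)) (y : Fin b → Ω → ℝ),
      Rank1Gauss P η A B a y → ∃ f : UpperVec d → ℝ,
        HasDensity (fun ω => symVec d (∑ i, outerSym (a i ω))) P volume f ∧
        ∀ x, f x ≤ K * Real.exp (-(1 / 4) * ‖x‖) := by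
  obtain ⟨K, hKtop, hK⟩ := exists_lintegral_pi_gaussianReal_le hb
  refine ⟨K.toReal, ENNReal.toReal_nonneg, fun P _ η A B a y h => ?_⟩
  have hofLp : Measurable (WithLp.ofLp : EuclideanSpace ℝ (Fin d) → Fin d → ℝ) := by fun_prop
  have ha : AEMeasurable (fun ω i => (a i ω).ofLp) P :=
    aemeasurable_pi_lambda _ fun i => hofLp.comp_aemeasurable (h.law_a i).aemeasurable
  have hH : Measurable fun X : Fin b → Fin d → ℝ =>
      (WithLp.toLp 2 (∑ i, outerUpper (X i)) : UpperVec d) :=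
    (by fun_prop : Measurable (WithLp.toLp 2 : (UpperIdx d → ℝ) → UpperVec d)).comp
      measurable_sum_outerUpper
  simp_rw [symVec_sum_outerSym]
  refine exists_hasDensity_le (hH.comp_aemeasurable ha) (by fun_prop) (fun x => by positivity)
    (Measure.le_iff.2 fun s hs => ?_)
  rw [← AEMeasurable.map_map_of_aemeasurable hH.aemeasurable ha, map_ofLp_eq_pi h,
    ← lintegral_indicator_one hs, lintegral_map (measurable_one.indicator hs) hH]
  refine (hK _ (measurable_one.indicator hs)).trans_eq ?_
  rw [withDensity_apply _ hs, ← lintegral_indicator hs, ← lintegral_const_mul' _ _ hKtop]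
  refine lintegral_congr fun x => ?_
  by_cases hx : x ∈ s
  · simp only [Set.indicator_of_mem hx, Pi.one_apply, one_mul]
    rw [ENNReal.ofReal_mul ENNReal.toReal_nonneg, ENNReal.ofReal_toReal hKtop]
  · simp only [Set.indicator_of_notMem hx, zero_mul, mul_zero]

theorem mainTheorem8 (d b : ℕ) (hb : d + 1 < b) :
    ∃ C : ℝ → ℝ, ∀ {Ω : Type*} [MeasurableSpace Ω] (P : Measure Ω) [IsProbabilityMeasure P]
      (η : ℝ) (A : Ω → Matrix (Fin d) (Fin d) ℝ) (B : Ω → EuclideanSpace ℝ (Fin d))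
      (a : Fin b → Ω → EuclideanSpace ℝ (Fin d)) (y : Fin b → Ω → ℝ),
      Rank1Gauss P η A B a y →
        (∃ f : UpperVec d → ℝ,
          HasDensity (fun ω => symVec d (∑ i, outerSym (a i ω))) P volume f ∧
          ∀ D : ℝ, 0 < D → ∀ x, f x ≤ C D * (1 + ‖x‖ ^ 2) ^ (-D)) ∧
        DecaySymm (fun ω => ∑ i, outerSym (a i ω)) P := by
  obtain ⟨K, hK0, hK⟩ := exists_hasDensity_symVec_le d b hb.le
  refine ⟨fun D => K * ((8 * D) ^ (2 * D) * Real.exp (1 / 4)), fun P _ η A B a y h => ?_⟩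
  obtain ⟨f, hf, hfK⟩ := hK P η A B a y h
  have hfD (D : ℝ) (hD : 0 < D) (x : UpperVec d) :
      f x ≤ K * ((8 * D) ^ (2 * D) * Real.exp (1 / 4)) * (1 + ‖x‖ ^ 2) ^ (-D) := by
    rw [mul_assoc]
    exact (hfK x).trans
      (mul_le_mul_of_nonneg_left (exp_neg_mul_le_one_add_sq_rpow hD (norm_nonneg x)) hK0)
  refine ⟨⟨f, hf, hfD⟩, fun g => f (symVec d g), hf.of_symVec, ?_⟩
  -- Any exponent above the threshold would do.
  set D : ℝ := (d : ℝ) * (d + 1) / 4 + 1 with hDdef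
  have hD : 0 < D := by positivity
  -- The factor `2 ^ D` pays for `1 + frobNorm g ^ 2 ≤ 2 * (1 + ‖symVec d g‖ ^ 2)`.
  refine ⟨K * ((8 * D) ^ (2 * D) * Real.exp (1 / 4)) * 2 ^ D, D, by linarith, fun g => ?_⟩
  refine (hfD D hD _).trans ?_
  rw [mul_assoc _ ((2 : ℝ) ^ D)]
  gcongr
  rw [Real.rpow_neg (by positivity), Real.rpow_neg (by positivity), ← div_eq_mul_inv,
    ← Real.inv_rpow (by positivity), ← Real.div_rpow (by norm_num) (by positivity)]
  refine Real.rpow_le_rpow (by positivity) ?_ hD.le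
  rw [inv_eq_one_div, div_le_div_iff₀ (by positivity) (by positivity)]
  linarith [frobNorm_sq_le g]
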